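/- Let $\mathbb F$ be $\mathbb R$ or $\mathbb C$; embeddings of Banach spaces over $\mathbb F$ are linear isometric embeddings. For an uncountable cardinal $\kappa$, a \emph{monster Banach space} (with respect to $\kappa$) is a Banach space $\mathcal B$ over $\mathbb F$ into which every Banach space of density character $<\kappa$ embeds, and in which every linear isometry between closed subspaces of density character $<\kappa$ extends to a surjective linear isometry of $\mathcal B$. A \emph{positive strongly bounded quantifier-free formula} is built by conjunctions and disjunctions from atomic formulas ``$\|t\|\in K$'', where $t$ is a term (a linear combination of variables with coefficients in $\mathbb F$) and $K\subset\mathbb R$ is compact. Write $\varphi\vdash\psi$ if every tuple in every Banach space that satisfies $\varphi$ satisfies $\psi$. Two tuples of a Banach space $M$ have the same type if there are two embeddings of $M$ into one Banach space, the first of which maps the first tuple to the same image as the second maps the second tuple; a sequence of tuples is indiscernible if all its finite increasing subsequences of the same length have the same type. Let $n\ge 3$. A formula $\varphi(\bar x,\bar y)$ with $\mathrm{len}(\bar x)=\mathrm{len}(\bar y)=k$ exemplifies $\mathrm{SOP}_n$ (respectively $\mathrm{SOP}_{\le n}$) in $\mathcal B$ if (a) for every infinite linear order $I$ with $|I|<\kappa$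 there is an indiscernible sequence $(\bar a_i)_{i\in I}$ of $k$-tuples of $\mathcal B$ such that $\varphi(\bar a_i,\bar a_j)$ holds whenever $i<j$; and (b) for $m=n$ (respectively for every $1\le m\le n$) there are no, not necessarily distinct, $k$-tuples $\bar c_0,\dots,\bar c_{m-1}$ in $\mathcal B$ such that $\varphi(\bar c_0,\bar c_1),\dots,\varphi(\bar c_{m-2},\bar c_{m-1})$ and $\varphi(\bar c_{m-1},\bar c_0)$ all hold. The class of Banach spaces over $\mathbb F$ has $\mathrm{SOP}_{\le n}$, exemplified by $\varphi$, if for every infinite linear order $I$ there is a Banach space $M$ over $\mathbb F$ that contains an indiscernible sequence as in (a) of order type $I$ and satisfies (b) for every $1\le m\le n$. \textbf{Theorem.} For every $n\ge3$, in every monster Banach space $\mathcal B$ the property $\mathrm{SOP}_n$ is exemplified by some positive strongly bounded quantifier-free formula. Moreover, there are positive strongly bounded quantifier-free formulas $\varphi_n(x_1x_2,y_1y_2)$ such that for every $n\ge 3$: $\varphi_n$ exemplifies $\mathrm{SOP}_{\le n}$ in every monster Banach space $\mathcal B$; the class of Banach spaces over $\mathbb F$ has $\mathrm{SOP}_{\le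 n}$, exemplified by $\varphi_n$; and $\varphi_{n+2}\vdash\varphi_n$. -/

import Mathlib

universe u

namespace BanachSOP

universe w

open Cardinal

/-! ### The logic: positive strongly bounded quantifier-free formulas -/

/-- Terms of the language of Banach spaces over `𝕜`, in variables from `α`. -/
inductive BTerm (𝕜 : Type) (α : Type w) : Type w
  | var : α → BTerm 𝕜 α
  | zero : BTerm 𝕜 α
  | add : BTerm 𝕜 α → BTerm 𝕜 α → BTerm 𝕜 α
  | smul : 𝕜 → BTerm 𝕜 α → BTerm 𝕜 α

/-- The value of a term under an assignment of its variables. -/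
def BTerm.eval {𝕜 : Type} {α : Type w} [RCLike 𝕜] {M : Type u}
    [NormedAddCommGroup M] [NormedSpace 𝕜 M] (a : α → M) : BTerm 𝕜 α → M
  | .var i => a i
  | .zero => 0
  | .add s t => s.eval a + t.eval a
  | .smul c t => c • t.eval a

/-- Positive strongly bounded quantifier-free formulas: the atomic formulas say that the norm of a
term lies in a given compact set of reals, and the formulas are closed under conjunction and
disjunction (there is no negation and there are no quantifiers). -/
inductive PSBFormula (𝕜 : Type) (α : Type w) : Type w
  | normMem (t : BTerm 𝕜 α) (K : Set ℝ) (hK : IsCompact K) : PSBFormula 𝕜 α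
  | conj : PSBFormula 𝕜 α → PSBFormula 𝕜 α → PSBFormula 𝕜 α
  | disj : PSBFormula 𝕜 α → PSBFormula 𝕜 α → PSBFormula 𝕜 α

/-- Satisfaction of a formula in a normed space under an assignment. -/
def PSBFormula.Holds {𝕜 : Type} {α : Type w} [RCLike 𝕜] {M : Type u}
    [NormedAddCommGroup M] [NormedSpace 𝕜 M] (a : α → M) : PSBFormula 𝕜 α → Prop
  | .normMem t K _ => ‖t.eval a‖ ∈ K
  | .conj p q => p.Holds a ∧ q.Holds a
  | .disj p q => p.Holds a ∨ q.Holds a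

/-- The binary relation (directed graph) on `k`-tuples of `M` which is defined by a formula
`φ(x̄, ȳ)` with `len x̄ = len ȳ = k`; the left summand of the index type holds the variables `x̄`,
the right one the variables `ȳ`. -/
def PSBFormula.Rel {𝕜 : Type} [RCLike 𝕜] {k : ℕ} (φ : PSBFormula 𝕜 (Fin k ⊕ Fin k)) {M : Type u}
    [NormedAddCommGroup M] [NormedSpace 𝕜 M] (x y : Fin k → M) : Prop :=
  φ.Holds (Sum.elim x y)

/-- `φ ⊢ ψ`: every pair of tuples of every Banach space that satisfies `φ` satisfies `ψ`. -/
def PSBFormula.Entails {𝕜 : Type} [RCLike 𝕜] {k : ℕ}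
    (φ ψ : PSBFormula 𝕜 (Fin k ⊕ Fin k)) : Prop :=
  ∀ (M : Type u) [NormedAddCommGroup M] [NormedSpace 𝕜 M] [CompleteSpace M] (x y : Fin k → M),
    φ.Rel x y → ψ.Rel x y

/-! ### Types and indiscernible sequences -/

/-- Equality of (Galois) types in the class of Banach spaces with linear isometric embeddings:
the two families of elements of `M` are identified by a pair of embeddings of `M` into a common
Banach space. -/
def SameType (𝕜 : Type) [RCLike 𝕜] {M : Type u} [NormedAddCommGroup M] [NormedSpace 𝕜 M]
    {ι : Type w} (a b : ι → M) : Prop :=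
  ∃ (N : Type u) (_ : NormedAddCommGroup N) (_ : NormedSpace 𝕜 N) (_ : CompleteSpace N)
    (f g : M →ₗᵢ[𝕜] N), ∀ i, f (a i) = g (b i)

/-- A sequence of `k`-tuples is indiscernible if any two of its finite increasing subsequences of
the same length have the same type. -/
def Indiscernible (𝕜 : Type) [RCLike 𝕜] {M : Type u} [NormedAddCommGroup M] [NormedSpace 𝕜 M]
    {k : ℕ} {I : Type u} [LinearOrder I] (a : I → Fin k → M) : Prop :=
  ∀ (m : ℕ) (s t : Fin m → I), StrictMono s → StrictMono t →
    SameType 𝕜 (fun p : Fin m × Fin k => a (s p.1) p.2) (fun p : Fin m × Fin k => a (t p.1) p.2)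

/-- In `M` there is an indiscernible chain of order type `I` for the relation defined by `φ`. -/
def HasIndiscernibleChain {𝕜 : Type} [RCLike 𝕜] {k : ℕ} (φ : PSBFormula 𝕜 (Fin k ⊕ Fin k))
    (M : Type u) [NormedAddCommGroup M] [NormedSpace 𝕜 M] (I : Type u) [LinearOrder I] : Prop :=
  ∃ a : I → Fin k → M, (∀ i j, i < j → φ.Rel (a i) (a j)) ∧ Indiscernible 𝕜 a

/-! ### The strong order properties -/

/-- A cycle `c 0 → c 1 → ⋯ → c (m - 1) → c m = c 0` of size `m` of a relation; the vertices need
not be distinct. -/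
def HasCycle {V : Type u} (R : V → V → Prop) (m : ℕ) : Prop :=
  ∃ c : ℕ → V, (∀ i < m, R (c i) (c (i + 1))) ∧ c m = c 0

/-- No cycles of size `n` in the graph which `φ` defines on `M`. -/
def NoCycle {𝕜 : Type} [RCLike 𝕜] {k : ℕ} (φ : PSBFormula 𝕜 (Fin k ⊕ Fin k)) (n : ℕ)
    (M : Type u) [NormedAddCommGroup M] [NormedSpace 𝕜 M] : Prop :=
  ¬ HasCycle (fun x y : Fin k → M => φ.Rel x y) n

/-- No cycles of size at most `n` in the graph which `φ` defines on `M`; in particular no loops. -/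
def NoCycleLE {𝕜 : Type} [RCLike 𝕜] {k : ℕ} (φ : PSBFormula 𝕜 (Fin k ⊕ Fin k)) (n : ℕ)
    (M : Type u) [NormedAddCommGroup M] [NormedSpace 𝕜 M] : Prop :=
  ∀ m, 1 ≤ m → m ≤ n → NoCycle φ m M

/-- `φ` exemplifies `SOP_n` in `M`, with indiscernible chains of every infinite order type of
cardinality less than `κ`. -/
def ExemplifiesSOP {𝕜 : Type} [RCLike 𝕜] {k : ℕ} (φ : PSBFormula 𝕜 (Fin k ⊕ Fin k)) (n : ℕ)
    (κ : Cardinal.{u}) (M : Type u) [NormedAddCommGroup M] [NormedSpace 𝕜 M] : Prop :=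
  (∀ (I : Type u) [LinearOrder I] [Infinite I], #I < κ → HasIndiscernibleChain φ M I) ∧
    NoCycle φ n M

/-- `φ` exemplifies `SOP_{≤ n}` in `M`, with indiscernible chains of every infinite order type of
cardinality less than `κ`. -/
def ExemplifiesSOPLE {𝕜 : Type} [RCLike 𝕜] {k : ℕ} (φ : PSBFormula 𝕜 (Fin k ⊕ Fin k)) (n : ℕ)
    (κ : Cardinal.{u}) (M : Type u) [NormedAddCommGroup M] [NormedSpace 𝕜 M] : Prop :=
  (∀ (I : Type u) [LinearOrder I] [Infinite I], #I < κ → HasIndiscernibleChain φ M I) ∧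
    NoCycleLE φ n M

/-- The class of all Banach spaces over `𝕜` has `SOP_{≤ n}`, exemplified by `φ`: for every infinite
linear order `I` there is a Banach space in which `φ` defines a graph with an indiscernible chain
of order type `I` and without cycles of size at most `n`. -/
def ClassExemplifiesSOPLE {𝕜 : Type} [RCLike 𝕜] {k : ℕ} (φ : PSBFormula 𝕜 (Fin k ⊕ Fin k))
    (n : ℕ) : Prop :=
  ∀ (I : Type u) [LinearOrder I] [Infinite I],
    ∃ (M : Type u) (_ : NormedAddCommGroup M) (_ : NormedSpace 𝕜 M) (_ : CompleteSpace M),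
      HasIndiscernibleChain φ M I ∧ NoCycleLE φ n M

/-! ### Monster Banach spaces -/

/-- The density character of `E` is less than `κ`. -/
def DensityLT (κ : Cardinal.{u}) (E : Type u) [TopologicalSpace E] : Prop :=
  ∃ s : Set E, Dense s ∧ #s < κ

/-- `B` is a monster Banach space over `𝕜` (a universal domain of the class of Banach spaces), with
respect to the uncountable cardinal `κ`: it is complete, it is `κ`-universal (every Banach space of
density character less than `κ` embeds into it) and strongly `κ`-homogeneous (every isomorphism
between closed subspaces of density character less than `κ` extends to an automorphism). Embeddings
are linear isometric embeddings. -/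
structure IsMonster (𝕜 : Type) [RCLike 𝕜] (κ : Cardinal.{u}) (B : Type u)
    [NormedAddCommGroup B] [NormedSpace 𝕜 B] : Prop where
  uncountable : ℵ₀ < κ
  complete : CompleteSpace B
  universal : ∀ (E : Type u) [NormedAddCommGroup E] [NormedSpace 𝕜 E] [CompleteSpace E],
    DensityLT κ E → Nonempty (E →ₗᵢ[𝕜] B)
  homogeneous : ∀ E : Submodule 𝕜 B, IsClosed (E : Set B) → DensityLT κ E →
    ∀ f : E →ₗᵢ[𝕜] B, ∃ F : B ≃ₗᵢ[𝕜] B, ∀ x : E, F x = f x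

end BanachSOP

/-!
The formula `φₙ` speaks about pairs `(d, a)`, `(d', a')` and says that `d = d'`, that `‖d‖ ≤ 1`,
that `‖d + a - a'‖ ≤ 1`, and that `‖n d + a' - a‖` lies in `[n + 1, n + 2]`.

There are no short cycles. The first coordinate `d` is constant along a cycle
`c 0 → c 1 → ⋯ → c m = c 0`, so adding up the steps from `c 1` to `c m` gives
`‖(m - 1) d + a₁ - a₀‖ ≤ m - 1`. When `m ≤ n` the triangle inequality yields `‖n d + a₁ - a₀‖ ≤ n`,
which contradicts the last clause for the first edge of the cycle
(`BanachSOP.noCycleLE_chainFormula`). The upper bound `n + 2` only serves to make the set of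
admitted values compact: it follows from the other clauses. This also gives the entailments.

Long chains exist. In `ℓ^∞` over the set of all upper sets of `I` let `d` be the constant function
`1`, and let `aᵢ` be the indicator function of the upper sets which contain `i`. For `i < j` the
function `d + aᵢ - aⱼ` has values in `{0, 1}`, and `n d + aⱼ - aᵢ` has the value `n + 1` at the upper
set `[j, ∞)`. The norm of a linear combination of `d` and of finitely many `aᵢ` depends only on the
order of the indices. By the Hahn-Banach theorem, equality of the norms of all linear combinations
is the same as equality of types (`BanachSOP.sameType_iff_norm_eq`), so the chain is indiscernible,
and it stays so under isometric embeddings. The closed span of the chain has density character at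
most `max ℵ₀ |I|`, so it embeds into every monster with `|I| < κ`.
-/

namespace BanachSOP

open Cardinal
open scoped ENNReal

/-! ### Equality of types in terms of norms -/

section Types

variable {𝕜 : Type} [RCLike 𝕜]

/-- The embedding of `M` into `ℓ^∞(Λ)` given by a norming family of functionals in the dual unit
ball. -/
noncomputable def normingEmbedding {M : Type u} [NormedAddCommGroup M] [NormedSpace 𝕜 M]
    {Λ : Type u} (F : Λ → StrongDual 𝕜 M) (hF : ∀ l, ‖F l‖ ≤ 1)
    (hn : ∀ x : M, ∃ l, F l x = (‖x‖ : 𝕜)) : M →ₗᵢ[𝕜] lp (fun _ : Λ => 𝕜) ∞ where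
  toFun x := ⟨fun l => F l x, memℓp_infty ⟨‖x‖, by
    rintro _ ⟨l, rfl⟩
    simpa using (F l).le_of_opNorm_le (hF l) x⟩⟩
  map_add' x y := by
    ext l
    exact map_add (F l) x y
  map_smul' c x := by
    ext l
    exact map_smul (F l) c x
  norm_map' x := by
    refine le_antisymm (lp.norm_le_of_forall_le (norm_nonneg x) fun l => ?_) ?_
    · simpa using (F l).le_of_opNorm_le (hF l) x
    · obtain ⟨l, hl⟩ := hn x
      refine le_trans (le_of_eq ?_) (lp.norm_apply_le_norm ENNReal.top_ne_zero _ l)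
      change ‖x‖ = ‖F l x‖
      simp [hl]

/-- A functional on `M` can be transported along the isometry of the spans of `a` and `b`, and then
extended. -/
theorem exists_dual_transport {M : Type u} [NormedAddCommGroup M] [NormedSpace 𝕜 M]
    {ι : Type w} [Fintype ι] {a b : ι → M}
    (h : ∀ c : ι → 𝕜, ‖∑ i, c i • a i‖ = ‖∑ i, c i • b i‖) (φ : StrongDual 𝕜 M) (hφ : ‖φ‖ ≤ 1) :
    ∃ ψ : StrongDual 𝕜 M, ‖ψ‖ ≤ 1 ∧ ∀ i, φ (a i) = ψ (b i) := by
  classical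
  let A := Fintype.linearCombination 𝕜 a
  let B := Fintype.linearCombination 𝕜 b
  have hAB : ∀ c, ‖A c‖ = ‖B c‖ := h
  obtain ⟨s, hs⟩ := B.rangeRestrict.exists_rightInverse_of_surjective B.range_rangeRestrict
  have hBs : ∀ y, B (s y) = y := fun y => congrArg Subtype.val (LinearMap.congr_fun hs y)
  let g : StrongDual 𝕜 (LinearMap.range B) :=
    LinearMap.mkContinuous (φ.toLinearMap ∘ₗ A ∘ₗ s) 1 fun y => by
      refine (φ.le_of_opNorm_le hφ (A (s y))).trans ?_
      rw [hAB, hBs]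
      rfl
  obtain ⟨ψ, hψ, hψn⟩ := exists_extension_norm_eq (LinearMap.range B) g
  refine ⟨ψ, hψn.trans_le (LinearMap.mkContinuous_norm_le _ zero_le_one _), fun i => ?_⟩
  have hA : A (Pi.single i 1) = a i := by simp [A]
  have hB : B (Pi.single i 1) = b i := by simp [B]
  let y : LinearMap.range B := ⟨b i, Pi.single i 1, hB⟩
  have hy : A (s y) = a i := by
    rw [← hA, ← sub_eq_zero, ← map_sub, ← norm_eq_zero, hAB, map_sub, hBs, hB]
    simp [y]
  have := hψ y
  rw [show ψ (b i) = g y from this]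
  exact (congrArg φ hy).symm

/-- The amalgam is `ℓ^∞` over the pairs of functionals in the dual unit ball which agree on the two
families. -/
theorem sameType_iff_norm_eq {M : Type u} [NormedAddCommGroup M] [NormedSpace 𝕜 M]
    {ι : Type w} [Fintype ι] {a b : ι → M} :
    SameType 𝕜 a b ↔ ∀ c : ι → 𝕜, ‖∑ i, c i • a i‖ = ‖∑ i, c i • b i‖ := by
  constructor
  · rintro ⟨N, _, _, _, f, g, hfg⟩ c
    rw [← f.norm_map, ← g.norm_map]
    simp [hfg]
  · intro h
    let Λ := {p : StrongDual 𝕜 M × StrongDual 𝕜 M //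
      ‖p.1‖ ≤ 1 ∧ ‖p.2‖ ≤ 1 ∧ ∀ i, p.1 (a i) = p.2 (b i)}
    refine ⟨lp (fun _ : Λ => 𝕜) ∞, inferInstance, inferInstance, inferInstance,
      normingEmbedding (fun l : Λ => l.1.1) (fun l => l.2.1) fun x => ?_,
      normingEmbedding (fun l : Λ => l.1.2) (fun l => l.2.2.1) fun x => ?_, fun i => ?_⟩
    · obtain ⟨φ, hφ, hx⟩ := exists_dual_vector'' 𝕜 x
      obtain ⟨ψ, hψ, hi⟩ := exists_dual_transport h φ hφ
      exact ⟨⟨(φ, ψ), hφ, hψ, hi⟩, hx⟩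
    · obtain ⟨ψ, hψ, hx⟩ := exists_dual_vector'' 𝕜 x
      obtain ⟨φ, hφ, hi⟩ := exists_dual_transport (fun c => (h c).symm) ψ hψ
      exact ⟨⟨(φ, ψ), hφ, hψ, fun i => (hi i).symm⟩, hx⟩
    · ext l
      exact l.2.2.2 i

theorem indiscernible_comp_iff {M E : Type u} [NormedAddCommGroup M] [NormedSpace 𝕜 M]
    [NormedAddCommGroup E] [NormedSpace 𝕜 E] (f : E →ₗᵢ[𝕜] M) {k : ℕ} {I : Type u} [LinearOrder I]
    (a : I → Fin k → E) : Indiscernible 𝕜 (fun i p => f (a i p)) ↔ Indiscernible 𝕜 a := by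
  simp only [Indiscernible, sameType_iff_norm_eq, ← map_smul, ← map_sum, f.norm_map]

theorem BTerm.eval_comp {M E : Type u} [NormedAddCommGroup M] [NormedSpace 𝕜 M]
    [NormedAddCommGroup E] [NormedSpace 𝕜 E] (f : E →ₗᵢ[𝕜] M) {α : Type w} (a : α → E)
    (t : BTerm 𝕜 α) : t.eval (f ∘ a) = f (t.eval a) := by
  induction t with
  | var i => rfl
  | zero => exact f.map_zero.symm
  | add s t hs ht => simp [BTerm.eval, hs, ht]
  | smul c t ht => simp [BTerm.eval, ht]

theorem PSBFormula.holds_comp_iff {M E : Type u} [NormedAddCommGroup M] [NormedSpace 𝕜 M]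
    [NormedAddCommGroup E] [NormedSpace 𝕜 E] (f : E →ₗᵢ[𝕜] M) {α : Type w} (a : α → E)
    (φ : PSBFormula 𝕜 α) : φ.Holds (f ∘ a) ↔ φ.Holds a := by
  induction φ with
  | normMem t K hK => simp [PSBFormula.Holds, BTerm.eval_comp]
  | conj p q hp hq => simp [PSBFormula.Holds, hp, hq]
  | disj p q hp hq => simp [PSBFormula.Holds, hp, hq]

theorem PSBFormula.rel_comp_iff {M E : Type u} [NormedAddCommGroup M] [NormedSpace 𝕜 M]
    [NormedAddCommGroup E] [NormedSpace 𝕜 E] (f : E →ₗᵢ[𝕜] M) {k : ℕ}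
    (φ : PSBFormula 𝕜 (Fin k ⊕ Fin k)) (x y : Fin k → E) :
    φ.Rel (fun p => f (x p)) (fun p => f (y p)) ↔ φ.Rel x y := by
  rw [PSBFormula.Rel, PSBFormula.Rel, ← φ.holds_comp_iff f, Sum.comp_elim]
  rfl

theorem HasIndiscernibleChain.map {M E : Type u} [NormedAddCommGroup M] [NormedSpace 𝕜 M]
    [NormedAddCommGroup E] [NormedSpace 𝕜 E] (f : E →ₗᵢ[𝕜] M) {k : ℕ}
    {φ : PSBFormula 𝕜 (Fin k ⊕ Fin k)} {I : Type u} [LinearOrder I]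
    (h : HasIndiscernibleChain φ E I) : HasIndiscernibleChain φ M I := by
  obtain ⟨a, ha, hi⟩ := h
  exact ⟨fun i p => f (a i p), fun i j hij => (φ.rel_comp_iff f _ _).2 (ha i j hij),
    (indiscernible_comp_iff f a).2 hi⟩

end Types

/-! ### Density character of a closed span -/

section Density

variable {𝕜 : Type} [RCLike 𝕜]

theorem mk_addSubmonoid_closure_le {M : Type u} [AddMonoid M] (s : Set M) :
    #(AddSubmonoid.closure s) ≤ max ℵ₀ #s := by
  have : ((AddSubmonoid.closure s : AddSubmonoid M) : Set M) ⊆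
      Set.range (fun l : List s => (l.map Subtype.val).sum) := by
    intro x hx
    obtain ⟨l, hl, rfl⟩ := AddSubmonoid.exists_list_of_mem_closure hx
    refine ⟨l.attach.map fun y => ⟨y.1, hl _ y.2⟩, ?_⟩
    simp
  exact (mk_le_mk_of_subset this).trans (mk_range_le.trans (mk_list_le_max s))

/-- The linear combinations with coefficients from a countable dense set of scalars are dense. -/
theorem exists_dense_topologicalClosure_span {M : Type u} [NormedAddCommGroup M] [NormedSpace 𝕜 M]
    (S : Set M) : ∃ s : Set (Submodule.span 𝕜 S).topologicalClosure,
      Dense s ∧ #s ≤ max ℵ₀ #S := by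
  obtain ⟨D, hDc, hD⟩ := TopologicalSpace.exists_countable_dense 𝕜
  let T : Set M := (fun q : 𝕜 × M => q.1 • q.2) '' (D ×ˢ S)
  let G : AddSubmonoid M := AddSubmonoid.closure T
  have hT : #T ≤ max ℵ₀ #S := by
    let e : D × S → M := fun q => q.1.1 • q.2.1
    have hTe : T ⊆ Set.range e := by
      rintro _ ⟨⟨c, x⟩, ⟨hc, hx⟩, rfl⟩
      exact ⟨(⟨c, hc⟩, ⟨x, hx⟩), rfl⟩
    have hD' : #D ≤ ℵ₀ := le_aleph0_iff_set_countable.2 hDc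
    refine (mk_le_mk_of_subset hTe).trans (mk_range_le.trans ?_)
    rw [mk_prod]
    refine (mul_le_max _ _).trans ?_
    refine max_le (max_le ?_ ?_) (le_max_left _ _)
    · exact le_max_of_le_left (lift_le_aleph0.2 hD')
    · simp
  have hspan : (Submodule.span 𝕜 S : Set M) ⊆ closure G := by
    intro x hx
    change x ∈ G.topologicalClosure
    refine Submodule.closure_induction (p := fun x _ => x ∈ G.topologicalClosure)
      (zero_mem _) (fun _ _ _ _ => add_mem) (fun c y hy => ?_) hx
    have : c ∈ closure D := hD c
    refine map_mem_closure (f := fun c : 𝕜 => c • y) (by fun_prop) this fun q hq => ?_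
    exact AddSubmonoid.subset_closure ⟨(q, y), ⟨hq, hy⟩, rfl⟩
  refine ⟨Subtype.val ⁻¹' (G : Set M), ?_, ?_⟩
  · have hG : (G : Set M) ⊆ (Submodule.span 𝕜 S).topologicalClosure := by
      have : G ≤ (Submodule.span 𝕜 S).topologicalClosure.toAddSubmonoid := by
        refine AddSubmonoid.closure_le.2 ?_
        rintro _ ⟨⟨c, x⟩, ⟨-, hx⟩, rfl⟩
        exact Submodule.le_topologicalClosure _
          (Submodule.smul_mem _ c (Submodule.subset_span hx))
      exact this
    rw [Subtype.dense_iff]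
    intro x hx
    refine closure_mono ?_ (closure_minimal hspan isClosed_closure hx)
    exact fun y hy => ⟨⟨y, hG hy⟩, hy, rfl⟩
  · refine (mk_preimage_of_injective _ _ Subtype.val_injective).trans ?_
    exact (mk_addSubmonoid_closure_le T).trans (max_le (le_max_left _ _) hT)

end Density

/-! ### The formula and its cycles -/

section Formula

variable {𝕜 : Type} [RCLike 𝕜]

/-- The formula `φₙ(x₁x₂, y₁y₂)`, with `x₁ = y₁` expressed by `‖x₁ - y₁‖ ∈ {0}`:
`x₁ = y₁`, `‖x₁‖ ≤ 1`, `‖x₁ + x₂ - y₂‖ ≤ 1` and `‖n x₁ + y₂ - x₂‖ ∈ [n + 1, n + 2]`. -/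
def chainFormula (𝕜 : Type) [RCLike 𝕜] (n : ℕ) : PSBFormula 𝕜 (Fin 2 ⊕ Fin 2) :=
  .conj
    (.conj
      (.normMem (.add (.var (.inl 0)) (.smul (-1) (.var (.inr 0)))) {0} isCompact_singleton)
      (.normMem (.var (.inl 0)) (Set.Icc 0 1) isCompact_Icc))
    (.conj
      (.normMem (.add (.var (.inl 0)) (.add (.var (.inl 1)) (.smul (-1) (.var (.inr 1)))))
        (Set.Icc 0 1) isCompact_Icc)
      (.normMem (.add (.smul n (.var (.inl 0)))
        (.add (.var (.inr 1)) (.smul (-1) (.var (.inl 1)))))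
        (Set.Icc (n + 1) (n + 2)) isCompact_Icc))

theorem rel_chainFormula_iff {M : Type u} [NormedAddCommGroup M] [NormedSpace 𝕜 M] {n : ℕ}
    {x y : Fin 2 → M} : (chainFormula 𝕜 n).Rel x y ↔
      x 0 = y 0 ∧ ‖x 0‖ ≤ 1 ∧ ‖x 0 + (x 1 - y 1)‖ ≤ 1 ∧ n + 1 ≤ ‖n • x 0 + (y 1 - x 1)‖ := by
  have key : ‖x 0‖ ≤ 1 → ‖x 0 + (x 1 - y 1)‖ ≤ 1 → ‖n • x 0 + (y 1 - x 1)‖ ≤ n + 2 := by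
    intro h₀ h₁
    have h : n • x 0 + (y 1 - x 1) = n • x 0 + (x 0 - (x 0 + (x 1 - y 1))) := by abel
    have hn : ‖n • x 0‖ ≤ n := (norm_nsmul_le).trans (mul_le_of_le_one_right n.cast_nonneg h₀)
    rw [h]
    linarith [norm_add_le (n • x 0) (x 0 - (x 0 + (x 1 - y 1))),
      norm_sub_le (x 0) (x 0 + (x 1 - y 1))]
  simp only [PSBFormula.Rel, chainFormula, PSBFormula.Holds, BTerm.eval, Sum.elim_inl,
    Sum.elim_inr, neg_smul, one_smul, ← sub_eq_add_neg, Set.mem_singleton_iff, norm_eq_zero,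
    sub_eq_zero, Set.mem_Icc, norm_nonneg, true_and, Nat.cast_smul_eq_nsmul]
  tauto

theorem entails_chainFormula {m n : ℕ} (hmn : m ≤ n) :
    PSBFormula.Entails.{u} (chainFormula 𝕜 n) (chainFormula 𝕜 m) := by
  intro M _ _ _ x y h
  rw [rel_chainFormula_iff] at h ⊢
  obtain ⟨h₀, h₁, h₂, h₃⟩ := h
  refine ⟨h₀, h₁, h₂, ?_⟩
  obtain ⟨r, rfl⟩ := Nat.exists_eq_add_of_le hmn
  have hr : ‖r • x 0‖ ≤ r := (norm_nsmul_le).trans (mul_le_of_le_one_right r.cast_nonneg h₁)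
  have h : (m + r) • x 0 + (y 1 - x 1) = (m • x 0 + (y 1 - x 1)) + r • x 0 := by
    rw [add_smul]
    abel
  rw [h] at h₃
  push_cast at h₃
  linarith [norm_add_le (m • x 0 + (y 1 - x 1)) (r • x 0)]

theorem noCycleLE_chainFormula (n : ℕ) (M : Type u) [NormedAddCommGroup M] [NormedSpace 𝕜 M] :
    NoCycleLE (chainFormula 𝕜 n) n M := by
  rintro m hm hmn ⟨c, hc, hcm⟩
  simp only [rel_chainFormula_iff] at hc
  obtain ⟨j, rfl⟩ := Nat.exists_eq_add_of_le' hm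
  have hd : ∀ i ≤ j + 1, c i 0 = c 0 0 := by
    intro i
    induction i with
    | zero => simp
    | succ i ih => exact fun hi => (hc i hi).1.symm.trans (ih (Nat.le_of_succ_le hi))
  have hsum : ∀ i ≤ j, ‖i • c 0 0 + (c 1 1 - c (i + 1) 1)‖ ≤ i := by
    intro i
    induction i with
    | zero => simp
    | succ i ih =>
      intro hi
      have h₁ := ih (Nat.le_of_succ_le hi)
      have h₂ := (hc (i + 1) (by omega)).2.2.1
      rw [hd (i + 1) (by omega)] at h₂
      have h : (i + 1) • c 0 0 + (c 1 1 - c (i + 1 + 1) 1) =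
          (i • c 0 0 + (c 1 1 - c (i + 1) 1)) + (c 0 0 + (c (i + 1) 1 - c (i + 1 + 1) 1)) := by
        rw [succ_nsmul]
        abel
      rw [h]
      push_cast
      exact (norm_add_le _ _).trans (add_le_add h₁ h₂)
  have h₁ := hsum j le_rfl
  rw [hcm] at h₁
  obtain ⟨-, h₂, -, h₃⟩ := hc 0 (by omega)
  obtain ⟨r, rfl⟩ := Nat.exists_eq_add_of_le (Nat.le_of_succ_le hmn)
  have hr : ‖r • c 0 0‖ ≤ r := (norm_nsmul_le).trans (mul_le_of_le_one_right r.cast_nonneg h₂)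
  have h : (j + r) • c 0 0 + (c (0 + 1) 1 - c 0 1) =
      (j • c 0 0 + (c 1 1 - c 0 1)) + r • c 0 0 := by
    rw [add_smul, zero_add]
    abel
  rw [h] at h₃
  push_cast at h₃
  linarith [norm_add_le (j • c 0 0 + (c 1 1 - c 0 1)) (r • c 0 0)]

end Formula

/-! ### The indiscernible chain -/

section Chain

variable (𝕜 : Type) [RCLike 𝕜] {I : Type u} [LinearOrder I]

open Classical in
/-- The function on the upper sets of `I` which is the `p`-th coordinate of the `i`-th pair of the
chain: the constant function `1` for `p = 0`, and the indicator function of `{U | i ∈ U}` for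
`p = 1`. -/
noncomputable def chainFun (i : I) (p : Fin 2) (U : UpperSet I) : 𝕜 :=
  if p = 0 ∨ i ∈ U then 1 else 0

theorem memℓp_chainFun (i : I) (p : Fin 2) : Memℓp (chainFun 𝕜 i p) ∞ := by
  refine memℓp_infty ⟨1, ?_⟩
  rintro _ ⟨U, rfl⟩
  by_cases h : p = 0 ∨ i ∈ U <;> simp [chainFun, h]

/-- The chain of pairs `(d, aᵢ)` in `ℓ^∞` over the upper sets of `I`. -/
noncomputable def chain (i : I) (p : Fin 2) : lp (fun _ : UpperSet I => 𝕜) ∞ :=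
  ⟨chainFun 𝕜 i p, memℓp_chainFun 𝕜 i p⟩

theorem chain_apply (i : I) (p : Fin 2) (U : UpperSet I) :
    chain 𝕜 i p U = chainFun 𝕜 i p U := rfl

theorem rel_chain (n : ℕ) {i j : I} (hij : i < j) :
    (chainFormula 𝕜 n).Rel (chain 𝕜 i) (chain 𝕜 j) := by
  rw [rel_chainFormula_iff]
  refine ⟨?_, ?_, ?_, ?_⟩
  · ext U
    simp [chain_apply, chainFun]
  · refine lp.norm_le_of_forall_le zero_le_one fun U => ?_
    simp [chain_apply, chainFun]
  · refine lp.norm_le_of_forall_le zero_le_one fun U => ?_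
    have hU : i ∈ U → j ∈ U := fun h => U.upper hij.le h
    by_cases hi : i ∈ U
    · simp [chain_apply, chainFun, hi, hU hi]
    · by_cases hj : j ∈ U <;> simp [chain_apply, chainFun, hi, hj]
  · refine le_trans (le_of_eq ?_)
      (lp.norm_apply_le_norm ENNReal.top_ne_zero _ (UpperSet.Ici j))
    have h : n • chainFun 𝕜 i 0 (UpperSet.Ici j) + (chainFun 𝕜 j 1 (UpperSet.Ici j) -
        chainFun 𝕜 i 1 (UpperSet.Ici j)) = ((n + 1 : ℕ) : 𝕜) := by
      simp [chainFun, hij]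
    change (n + 1 : ℝ) = ‖n • chainFun 𝕜 i 0 (UpperSet.Ici j) + (chainFun 𝕜 j 1 (UpperSet.Ici j) -
        chainFun 𝕜 i 1 (UpperSet.Ici j))‖
    rw [h, RCLike.norm_natCast]
    push_cast
    rfl

theorem sum_chain_apply {m : ℕ} (s : Fin m → I) (c : Fin m × Fin 2 → 𝕜) (U : UpperSet I) :
    (∑ p, c p • chain 𝕜 (s p.1) p.2) U = ∑ p, c p * chainFun 𝕜 (s p.1) p.2 U := by
  rw [lp.coeFn_sum]
  exact Finset.sum_apply U Finset.univ _

/-- Every value of a linear combination of the pairs with indices `s` is also a value of the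
combination with the same coefficients of the pairs with indices `t`. -/
theorem norm_sum_chain_le {m : ℕ} {s t : Fin m → I} (hs : StrictMono s) (ht : StrictMono t)
    (c : Fin m × Fin 2 → 𝕜) :
    ‖∑ p, c p • chain 𝕜 (s p.1) p.2‖ ≤ ‖∑ p, c p • chain 𝕜 (t p.1) p.2‖ := by
  refine lp.norm_le_of_forall_le (norm_nonneg _) fun U => ?_
  let V : UpperSet I := ⟨{j | ∃ p, s p ∈ U ∧ t p ≤ j}, by
    rintro i j hij ⟨p, hp, hpi⟩
    exact ⟨p, hp, hpi.trans hij⟩⟩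
  have hV : ∀ q, t q ∈ V ↔ s q ∈ U := by
    intro q
    constructor
    · rintro ⟨p, hp, hpq⟩
      exact U.upper (hs.monotone (ht.le_iff_le.1 hpq)) hp
    · exact fun hq => ⟨q, hq, le_rfl⟩
  have hUV : ∀ p : Fin m × Fin 2, chainFun 𝕜 (s p.1) p.2 U = chainFun 𝕜 (t p.1) p.2 V :=
    fun p => by classical exact if_congr (or_congr_right (hV p.1).symm) rfl rfl
  refine le_trans (le_of_eq ?_) (lp.norm_apply_le_norm ENNReal.top_ne_zero _ V)
  simp only [sum_chain_apply, hUV]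

theorem indiscernible_chain : Indiscernible 𝕜 (chain 𝕜 : I → Fin 2 → _) := fun _ _ _ hs ht =>
  sameType_iff_norm_eq.2 fun c =>
    le_antisymm (norm_sum_chain_le 𝕜 hs ht c) (norm_sum_chain_le 𝕜 ht hs c)

/-- The space is the closed span of `chain 𝕜`. -/
theorem exists_hasIndiscernibleChain (I : Type u) [LinearOrder I] [Infinite I] (n : ℕ) :
    ∃ (E : Type u) (_ : NormedAddCommGroup E) (_ : NormedSpace 𝕜 E) (_ : CompleteSpace E),
      HasIndiscernibleChain (chainFormula 𝕜 n) E I ∧ ∃ s : Set E, Dense s ∧ #s ≤ #I := by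
  let S : Set (lp (fun _ : UpperSet I => 𝕜) ∞) :=
    Set.range fun q : I × Fin 2 => chain 𝕜 q.1 q.2
  let E := (Submodule.span 𝕜 S).topologicalClosure
  have hE : IsClosed (E : Set (lp (fun _ : UpperSet I => 𝕜) ∞)) :=
    Submodule.isClosed_topologicalClosure _
  let a : I → Fin 2 → E := fun i p =>
    ⟨chain 𝕜 i p, Submodule.le_topologicalClosure _ (Submodule.subset_span ⟨(i, p), rfl⟩)⟩
  refine ⟨E, inferInstance, inferInstance, hE.completeSpace_coe,
    ⟨a, fun i j hij => ?_, ?_⟩, ?_⟩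
  · exact ((chainFormula 𝕜 n).rel_comp_iff E.subtypeₗᵢ (a i) (a j)).1 (rel_chain 𝕜 n hij)
  · exact (indiscernible_comp_iff E.subtypeₗᵢ a).1 (indiscernible_chain 𝕜)
  · obtain ⟨s, hs, hcard⟩ := exists_dense_topologicalClosure_span (𝕜 := 𝕜) S
    refine ⟨s, hs, hcard.trans (max_le (aleph0_le_mk I) (mk_range_le.trans ?_))⟩
    rw [mk_prod]
    refine (mul_le_max _ _).trans ?_
    have : (2 : Cardinal.{u}) ≤ #I := (ofNat_lt_aleph0 (n := 2)).le.trans (aleph0_le_mk I)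
    simp [this]

end Chain

theorem exemplifiesSOPLE_chainFormula {𝕜 : Type} [RCLike 𝕜] {κ : Cardinal.{u}} {B : Type u}
    [NormedAddCommGroup B] [NormedSpace 𝕜 B] (hB : IsMonster 𝕜 κ B) (n : ℕ) :
    ExemplifiesSOPLE (chainFormula 𝕜 n) n κ B := by
  refine ⟨fun I _ _ hI => ?_, noCycleLE_chainFormula n B⟩
  obtain ⟨E, _, _, _, hE, s, hs, hcard⟩ := exists_hasIndiscernibleChain 𝕜 I n
  obtain ⟨f⟩ := hB.universal E ⟨s, hs, hcard.trans_lt hI⟩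
  exact hE.map f

theorem classExemplifiesSOPLE_chainFormula (𝕜 : Type) [RCLike 𝕜] (n : ℕ) :
    ClassExemplifiesSOPLE.{u} (chainFormula 𝕜 n) n := by
  intro I _ _
  obtain ⟨E, i₁, i₂, i₃, hE, -⟩ := exists_hasIndiscernibleChain 𝕜 I n
  exact ⟨E, i₁, i₂, i₃, hE, noCycleLE_chainFormula n E⟩

end BanachSOP

theorem mainTheorem1 (𝕜 : Type) [RCLike 𝕜] :
    (∀ (κ : Cardinal.{u}) (B : Type u) [NormedAddCommGroup B] [NormedSpace 𝕜 B],
      BanachSOP.IsMonster 𝕜 κ B → ∀ n : ℕ, 3 ≤ n →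
        ∃ (k : ℕ) (φ : BanachSOP.PSBFormula 𝕜 (Fin k ⊕ Fin k)),
          BanachSOP.ExemplifiesSOP φ n κ B) ∧
    ∃ φ : ℕ → BanachSOP.PSBFormula 𝕜 (Fin 2 ⊕ Fin 2),
      (∀ n : ℕ, 3 ≤ n →
        (∀ (κ : Cardinal.{u}) (B : Type u) [NormedAddCommGroup B] [NormedSpace 𝕜 B],
          BanachSOP.IsMonster 𝕜 κ B → BanachSOP.ExemplifiesSOPLE (φ n) n κ B) ∧
        BanachSOP.ClassExemplifiesSOPLE.{u} (φ n) n) ∧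
      ∀ n : ℕ, 3 ≤ n → BanachSOP.PSBFormula.Entails.{u} (φ (n + 2)) (φ n) := by
  refine ⟨fun κ B _ _ hB n hn => ?_, BanachSOP.chainFormula 𝕜,
    fun n _ => ⟨fun κ B _ _ hB => ?_, ?_⟩,
    fun n _ => BanachSOP.entails_chainFormula (Nat.le_add_right n 2)⟩
  · obtain ⟨h₁, h₂⟩ := BanachSOP.exemplifiesSOPLE_chainFormula hB n
    exact ⟨2, BanachSOP.chainFormula 𝕜 n, h₁, h₂ n (by omega) le_rfl⟩
  · exact BanachSOP.exemplifiesSOPLE_chainFormula hB n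
  · exact BanachSOP.classExemplifiesSOPLE_chainFormula 𝕜 n
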